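/- For $n\ge 0$ let $F_n$ be the $n$-th Koch graph in the plane: $F_0$ is the single edge from $(0,0)$ to $(1,0)$, and $F_n$ arises from $F_{n-1}$ by replacing every edge $pq$ (oriented along the path from $(0,0)$ to $(1,0)$) by the four edges of the path $p,\ p+\tfrac13(q-p),\ a,\ p+\tfrac23(q-p),\ q$, where $a$ is the apex of the equilateral triangle erected on the middle third of $pq$ on its left (outer) side. So $F_n$ is a path with $4^n$ edges of length $3^{-n}$. Let $H$ be a graph whose vertices are points of the plane and whose edges are straight segments. For a path $P$ in $H$ from $u$ to $v$, let $d_F(P,\overline{uv})$ be the Fréchet distance of the polygonal curve $P$ and the segment $\overline{uv}$, i.e. the infimum over all pairs of continuous non-decreasing maps $\alpha,\beta:[0,1]\to[0,1]$ fixing $0$ and $1$ of the maximum over $\tau$ of the distance of $P(\alpha(\tau))$ and the point $u+\beta(\tau)(v-u)$. The graph $H$ is a *$t$-spanner* if any two vertices $u,v$ are joined in $H$ by a path of total Euclidean length at most $t\cdot d(u,v)$, and an *$\varepsilon$-Fréchet-spanner* if any two vertices $u,v$ are joined in $H$ by a path $P$ with $d_F(P,\overline{uv})\le\varepsilon\cdot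 d(u,v)$. **Theorem.** There is a constant $c$ with $0<c\le 6$ such that: 1. for every $n\ge 0$ the graph $F_n$ is a $c$-Fréchet-spanner; 2. for every $n\ge 0$ and any two distinct vertices $u,v$ of $F_n$, if $P(u,v)$ is the path in $F_n$ from $u$ to $v$, then there is a (not necessarily axis-parallel) rectangle $R$ that contains both $P(u,v)$ and $\overline{uv}$ and whose diagonal has a length $\delta$ with $d_F(P(u,v),\overline{uv})\le\delta\le c\cdot d(u,v)$; 3. for every $t>1$ there is an $n$ such that $F_n$ is not a $t$-spanner. In particular, for every $t>1$ some graph is a $c$-Fréchet-spanner but not a $t$-spanner. -/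

import Mathlib

noncomputable section

namespace FrechetSpanner

/-! ### Curves and the Fréchet distance -/

/-- The Fréchet distance of two curves `γ₁`, `γ₂` (parametrized by `[0,1]`): the infimum of the leash
lengths `r` for which a dog on `γ₁` and its owner on `γ₂`, moving continuously from the start to the end
of their curves without backtracking (according to the monotone time changes `α` and `β`), can
always stay within distance `r` of each other. -/
def frechetDist {E : Type*} [PseudoMetricSpace E] {a b a' b' : E}
    (γ₁ : Path a b) (γ₂ : Path a' b') : ℝ :=
  sInf {r : ℝ | ∃ α β : unitInterval → unitInterval,
    Continuous α ∧ Monotone α ∧ α 0 = 0 ∧ α 1 = 1 ∧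
    Continuous β ∧ Monotone β ∧ β 0 = 0 ∧ β 1 = 1 ∧
    ∀ τ, dist (γ₁ (α τ)) (γ₂ (β τ)) ≤ r}

/-! ### Geometric graphs

A subgraph of the Euclidean graph over a point set `S ⊆ ℝᵈ` is a simple graph on the vertex set `S`;
the edge `{u, v}` is the straight segment `uv`, of weight `dist u v`. -/

section GeometricGraphs

variable {d : ℕ} {S : Set (EuclideanSpace ℝ (Fin d))} {H : SimpleGraph S}

/-- The total Euclidean length of a walk. -/
def walkLength {u v : S} : H.Walk u v → ℝ
  | .nil => 0
  | .cons (u := u) (v := w) _ p => dist u w + walkLength p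

/-- The polygonal curve traced by a walk. -/
def polygonalCurve {u v : S} : H.Walk u v →
    Path (u : EuclideanSpace ℝ (Fin d)) (v : EuclideanSpace ℝ (Fin d))
  | .nil => Path.refl _
  | .cons (u := u) (v := w) _ p =>
      (Path.segment (u : EuclideanSpace ℝ (Fin d)) w).trans (polygonalCurve p)

/-- `d_F(P, uv)`: the Fréchet distance of a walk `P` from `u` to `v` to the segment `uv`. -/
def frechetDistToSegment {u v : S} (P : H.Walk u v) : ℝ :=
  frechetDist (polygonalCurve P)
    (Path.segment (u : EuclideanSpace ℝ (Fin d)) (v : EuclideanSpace ℝ (Fin d)))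

/-- `H` is a `t`-spanner of `S`: any two points are joined in `H` by a path of length at most
`t` times their distance. -/
def IsSpanner (t : ℝ) (H : SimpleGraph S) : Prop :=
  ∀ u v : S, ∃ P : H.Walk u v, P.IsPath ∧ walkLength P ≤ t * dist u v

/-- `H` is an `ε`-Fréchet-spanner of `S`: any two points `u`, `v` are joined in `H` by a path whose
Fréchet distance to the segment `uv` is at most `ε` times the distance of `u` and `v`. -/
def IsFrechetSpanner (ε : ℝ) (H : SimpleGraph S) : Prop :=
  ∀ u v : S, ∃ P : H.Walk u v, P.IsPath ∧ frechetDistToSegment P ≤ ε * dist u v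

end GeometricGraphs

/-! ### Rectangles -/

/-- A (not necessarily axis-parallel) rectangle in the plane, given by a corner, the unit directions of
two adjacent sides and the lengths of these sides. -/
structure Rectangle where
  corner : EuclideanSpace ℝ (Fin 2)
  dir₁ : EuclideanSpace ℝ (Fin 2)
  dir₂ : EuclideanSpace ℝ (Fin 2)
  side₁ : ℝ
  side₂ : ℝ
  norm_dir₁ : ‖dir₁‖ = 1
  norm_dir₂ : ‖dir₂‖ = 1
  orthogonal : inner ℝ dir₁ dir₂ = 0
  side₁_pos : 0 < side₁
  side₂_pos : 0 < side₂

/-- The closed region bounded by a rectangle. -/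
def Rectangle.region (R : Rectangle) : Set (EuclideanSpace ℝ (Fin 2)) :=
  {p | ∃ x y : ℝ, 0 ≤ x ∧ x ≤ R.side₁ ∧ 0 ≤ y ∧ y ≤ R.side₂ ∧
    p = R.corner + x • R.dir₁ + y • R.dir₂}

/-- The length of a diagonal of a rectangle. -/
def Rectangle.diagonal (R : Rectangle) : ℝ := √(R.side₁ ^ 2 + R.side₂ ^ 2)

/-! ### The Koch graphs -/

/-- Counterclockwise rotation of a planar vector by the angle `π / 3`. -/
def rot60 (p : EuclideanSpace ℝ (Fin 2)) : EuclideanSpace ℝ (Fin 2) :=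
  !₂[p 0 / 2 - √3 / 2 * p 1, √3 / 2 * p 0 + p 1 / 2]

/-- The vertices of the `n`-th Koch graph in their order along the curve, which are the values at
`k = 0, …, 4 ^ n`. For `n = 0` they are `(0,0)` and `(1,0)`. In the step from `n` to `n + 1`, the
`j`-th edge `pq` is replaced by four edges with the vertices `p`, `p + (q - p) / 3`, the apex of the
equilateral triangle erected on the outer (left) side of the middle third of `pq`,
`p + 2 (q - p) / 3`, and `q`. -/
def kochVertex : ℕ → ℕ → EuclideanSpace ℝ (Fin 2)
  | 0, k => if k = 0 then !₂[0, 0] else !₂[1, 0]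
  | n + 1, k =>
      let p := kochVertex n (k / 4)
      let q := kochVertex n (k / 4 + 1)
      let s := (1 / 3 : ℝ) • (q - p)
      if k % 4 = 0 then p
      else if k % 4 = 1 then p + s
      else if k % 4 = 2 then p + s + rot60 s
      else p + (2 : ℝ) • s

/-- The vertex set of the `n`-th Koch graph. -/
def kochVertexSet (n : ℕ) : Set (EuclideanSpace ℝ (Fin 2)) :=
  {p | ∃ k ≤ 4 ^ n, p = kochVertex n k}

/-- The `n`-th Koch graph `F_n`: its edges join consecutive vertices of the curve. -/
def kochGraph (n : ℕ) : SimpleGraph (kochVertexSet n) :=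
  SimpleGraph.fromRel fun u v => ∃ k < 4 ^ n,
    (u : EuclideanSpace ℝ (Fin 2)) = kochVertex n k ∧
    (v : EuclideanSpace ℝ (Fin 2)) = kochVertex n (k + 1)

end FrechetSpanner

end

namespace FrechetSpanner

/-! ### The Koch graphs in complex coordinates -/

/-! A rectangle is convex and its diameter is its diagonal, so if it contains the vertices of a path
from u to v, it contains the path and the segment, and any two points of these are within one
diagonal of each other. Hence the first two claims reduce to one: the vertices between u and v lie
in a rectangle of diagonal at most 6 d(u,v). This is `boxBound_kochPoint`.

It is proved by induction on n, since F_{n+1} consists of four copies of F_n scaled by 1/3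
(`kochPoint_similar`). If u and v lie in one copy, the rectangle for F_n is transported. If a copy
separates theirs, their real parts differ by at least 1/6, while the whole curve stays in a fixed
triangle. If the copies are adjacent, each piece lies in a triangle with base angle π/6 at the
common vertex, of base at most three times the distance from that vertex to u or v
(`exists_initial_triangle`, `exists_final_triangle`). The two triangles leave an angle of at least
π/3, so u and v cannot be close compared with either base (`boxBound_adjacent`).

The spanner property fails because the ends of F_n have distance 1, while every walk between them
has length at least (4/3)^n. -/

/-- The sixth root of unity `exp (i π / 3)`. -/
noncomputable def root60 : ℂ := ⟨1 / 2, √3 / 2⟩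

/-- The vertices of the Koch graphs as complex numbers. -/
noncomputable def kochPoint (n k : ℕ) : ℂ := ⟨kochVertex n k 0, kochVertex n k 1⟩

/-- The vertices of the first Koch graph as complex numbers. -/
noncomputable def kochStep (i : ℕ) : ℂ :=
  if i = 0 then 0 else if i = 1 then 1 / 3 else if i = 2 then 1 / 3 + 1 / 3 * root60
  else if i = 3 then 2 / 3 else 1

/-- The edge vectors of the first Koch graph. -/
noncomputable def kochEdge (i : ℕ) : ℂ := kochStep (i + 1) - kochStep i

theorem sqrt_three_sq : √3 * √3 = (3 : ℝ) := Real.mul_self_sqrt (by norm_num)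

theorem root60_sq : root60 * root60 = root60 - 1 := by
  apply Complex.ext <;> simp [root60] <;> nlinarith [sqrt_three_sq]

theorem norm_root60 : ‖root60‖ = 1 := by
  rw [Complex.norm_def, Complex.normSq_apply]
  simp only [root60]
  rw [show (1 / 2 * (1 / 2) + √3 / 2 * (√3 / 2) : ℝ) = 1 by nlinarith [sqrt_three_sq]]
  simp

theorem norm_one_sub_root60 : ‖1 - root60‖ = 1 := by
  rw [Complex.norm_def, Complex.normSq_apply]
  simp only [root60, Complex.sub_re, Complex.sub_im, Complex.one_re, Complex.one_im]
  rw [show ((1 - 1 / 2) * (1 - 1 / 2) + (0 - √3 / 2) * (0 - √3 / 2) : ℝ) = 1 by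
    nlinarith [sqrt_three_sq]]
  simp

theorem kochEdge_zero : kochEdge 0 = 1 / 3 := by simp [kochEdge, kochStep]
theorem kochEdge_one : kochEdge 1 = 1 / 3 * root60 := by simp [kochEdge, kochStep]
theorem kochEdge_two : kochEdge 2 = 1 / 3 * (1 - root60) := by
  simp [kochEdge, kochStep]; ring
theorem kochEdge_three : kochEdge 3 = 1 / 3 := by
  simp [kochEdge, kochStep]; norm_num

theorem norm_kochEdge {i : ℕ} (hi : i < 4) : ‖kochEdge i‖ = 1 / 3 := by
  interval_cases i
  · simp [kochEdge_zero]
  · simp [kochEdge_one, norm_root60]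
  · simp [kochEdge_two, norm_one_sub_root60]
  · simp [kochEdge_three]

theorem kochEdge_ne_zero {i : ℕ} (hi : i < 4) : kochEdge i ≠ 0 := by
  rw [← norm_ne_zero_iff, norm_kochEdge hi]; norm_num

theorem kochPoint_zero_zero : kochPoint 0 0 = 0 := by
  apply Complex.ext <;> simp [kochPoint, kochVertex]

theorem kochPoint_zero_one : kochPoint 0 1 = 1 := by
  apply Complex.ext <;> simp [kochPoint, kochVertex]

theorem kochPoint_succ_of_mod_eq_zero {n k : ℕ} (h : k % 4 = 0) :
    kochPoint (n + 1) k = kochPoint n (k / 4) := by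
  simp [kochPoint, kochVertex, h]

theorem kochPoint_succ (n k : ℕ) :
    kochPoint (n + 1) k = kochPoint n (k / 4) +
      kochStep (k % 4) * (kochPoint n (k / 4 + 1) - kochPoint n (k / 4)) := by
  have h4 : k % 4 < 4 := Nat.mod_lt _ (by norm_num)
  generalize hr : k % 4 = r at h4
  interval_cases r
  · simp [kochPoint_succ_of_mod_eq_zero hr, kochStep]
  all_goals
    apply Complex.ext <;>
    · simp [kochPoint, kochVertex, hr, kochStep, root60, rot60]
      try ring

/-- The definition refines each edge of F_n; this reads the recursion from the outside, as four
similar copies. The two views agree because the refinement of an edge is affine in its ends. -/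
theorem kochPoint_similar {i : ℕ} (hi : i < 4) (n : ℕ) {k : ℕ} (hk : k ≤ 4 ^ n) :
    kochPoint (n + 1) (i * 4 ^ n + k) = kochStep i + kochEdge i * kochPoint n k := by
  induction n generalizing k with
  | zero =>
    have : k = 0 ∨ k = 1 := by simp at hk; omega
    rw [kochPoint_succ]
    rcases this with rfl | rfl
    · have h1 : (i * 4 ^ 0 + 0) / 4 = 0 := by omega
      have h2 : (i * 4 ^ 0 + 0) % 4 = i := by omega
      rw [h1, h2, kochPoint_zero_zero, zero_add, kochPoint_zero_one]
      simp
    · obtain h | rfl : i < 3 ∨ i = 3 := by omega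
      · have h1 : (i * 4 ^ 0 + 1) / 4 = 0 := by omega
        have h2 : (i * 4 ^ 0 + 1) % 4 = i + 1 := by omega
        rw [h1, h2, kochPoint_zero_zero, zero_add, kochPoint_zero_one]
        simp [kochEdge]
      · norm_num [kochPoint_zero_one, kochEdge, kochStep]
  | succ n ih =>
    have h3 : 4 ^ (n + 1) = 4 * 4 ^ n := by ring
    have h0 : i * 4 ^ (n + 1) = 4 * (i * 4 ^ n) := by ring
    have h1 : (i * 4 ^ (n + 1) + k) / 4 = i * 4 ^ n + k / 4 := by omega
    have h2 : (i * 4 ^ (n + 1) + k) % 4 = k % 4 := by omega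
    have hq : k / 4 ≤ 4 ^ n := by omega
    -- At the last index `k / 4 + 1` exceeds `4 ^ n`, out of reach of `ih`; there `k % 4 = 0` and
    -- only `k / 4` is needed.
    by_cases hr : k % 4 = 0
    · rw [kochPoint_succ_of_mod_eq_zero (by omega), h1, ih hq,
        kochPoint_succ_of_mod_eq_zero hr]
    · rw [kochPoint_succ (n + 1), h1, h2, add_assoc, ih hq, ih (by omega), kochPoint_succ n k]
      ring

/-- Every index of `F_{n+1}` lies in one of the four copies of `F_n`, not at its end. -/
theorem exists_copy_of_lt {n k : ℕ} (hk : k < 4 ^ (n + 1)) :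
    ∃ i < 4, ∃ l < 4 ^ n, k = i * 4 ^ n + l := by
  have h0 : 0 < 4 ^ n := by positivity
  refine ⟨k / 4 ^ n, ?_, k % 4 ^ n, Nat.mod_lt _ h0, ?_⟩
  · rw [Nat.div_lt_iff_lt_mul h0]; rw [pow_succ] at hk; omega
  · rw [mul_comm]; exact (Nat.div_add_mod _ _).symm

/-- Every index of `F_{n+1}` lies in one of the four copies of `F_n`, not at its start. -/
theorem exists_copy_of_pos {n k : ℕ} (h0 : 0 < k) (hk : k ≤ 4 ^ (n + 1)) :
    ∃ i < 4, ∃ l, 0 < l ∧ l ≤ 4 ^ n ∧ k = i * 4 ^ n + l := by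
  obtain ⟨i, hi, l, hl, h⟩ := exists_copy_of_lt (n := n) (k := k - 1) (by omega)
  exact ⟨i, hi, l + 1, by omega, by omega, by omega⟩

theorem kochPoint_zero_right (n : ℕ) : kochPoint n 0 = 0 := by
  induction n with
  | zero => exact kochPoint_zero_zero
  | succ n ih => rw [kochPoint_succ_of_mod_eq_zero (by simp)]; simpa using ih

theorem kochPoint_last (n : ℕ) : kochPoint n (4 ^ n) = 1 := by
  induction n with
  | zero => simpa using kochPoint_zero_one
  | succ n ih =>
    have h : 4 ^ (n + 1) = 3 * 4 ^ n + 4 ^ n := by ring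
    rw [h, kochPoint_similar (by norm_num) n le_rfl, ih, kochEdge]
    simp [kochStep]

theorem norm_kochPoint_succ_sub {n k : ℕ} (hk : k < 4 ^ n) :
    ‖kochPoint n (k + 1) - kochPoint n k‖ = (1 / 3) ^ n := by
  induction n generalizing k with
  | zero =>
    obtain rfl : k = 0 := by simpa using hk
    simp [kochPoint_zero_zero, kochPoint_zero_one]
  | succ n ih =>
    obtain ⟨i, hi, l, hl, rfl⟩ := exists_copy_of_lt hk
    rw [add_assoc, kochPoint_similar hi n (by omega), kochPoint_similar hi n hl.le,
      add_sub_add_left_eq_sub, ← mul_sub, norm_mul, ih hl, norm_kochEdge hi, pow_succ, mul_comm]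

/-! ### Triangles and rectangles around pieces of the curve -/

/-- The isosceles triangle with base `[0, L]` and base angles `π / 6` above the real axis. -/
def triangle (L : ℝ) : Set ℂ := {z | 0 ≤ z.im ∧ √3 * z.im ≤ z.re ∧ √3 * z.im ≤ L - z.re}

theorem triangle_mono {L M : ℝ} (h : L ≤ M) : triangle L ⊆ triangle M :=
  fun _ hz => ⟨hz.1, hz.2.1, hz.2.2.trans (by linarith)⟩

theorem kochStep_add_mem_triangle {i : ℕ} (hi : i < 4) {z : ℂ} (hz : z ∈ triangle 1) :
    kochStep i + kochEdge i * z ∈ triangle 1 := by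
  obtain ⟨h1, h2, h3⟩ := hz
  have hs : 0 < √3 := by positivity
  have h := sqrt_three_sq
  have e1 := mul_le_mul_of_nonneg_left h2 hs.le
  have e2 := mul_le_mul_of_nonneg_left h3 hs.le
  have e3 := mul_nonneg hs.le h1
  rw [← mul_assoc, h] at e1 e2
  interval_cases i <;>
  simp only [kochEdge_zero, kochEdge_one, kochEdge_two, kochEdge_three] <;>
  simp [kochStep, triangle, root60] <;> refine ⟨?_, ?_, ?_⟩ <;> nlinarith

theorem kochPoint_mem_triangle {n k : ℕ} (hk : k ≤ 4 ^ n) : kochPoint n k ∈ triangle 1 := by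
  induction n generalizing k with
  | zero =>
    have : k = 0 ∨ k = 1 := by simp at hk; omega
    rcases this with rfl | rfl <;> simp [kochPoint_zero_zero, kochPoint_zero_one, triangle]
  | succ n ih =>
    rcases Nat.eq_zero_or_pos k with rfl | h0
    · rw [kochPoint_zero_right]; simp [triangle]
    obtain ⟨i, hi, l, -, hl, rfl⟩ := exists_copy_of_pos h0 hk
    rw [kochPoint_similar hi n hl]
    exact kochStep_add_mem_triangle hi (ih hl)

/-- The triangle over the second edge has a vertical side at 1/3, since 60° + 30° = 90°. So the four
small triangles project to [0, 1/3], [1/3, 1/2], [1/2, 2/3] and [2/3, 1]. -/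
theorem re_kochStep_add_ge {i : ℕ} (hi : i < 4) {z : ℂ} (hz : z ∈ triangle 1) :
    (if i = 0 then 0 else if i = 1 then 1 / 3 else if i = 2 then 1 / 2 else 2 / 3) ≤
      (kochStep i + kochEdge i * z).re := by
  obtain ⟨h1, h2, h3⟩ := hz
  have hs : 0 < √3 := by positivity
  have h := sqrt_three_sq
  interval_cases i <;>
  simp only [kochEdge_zero, kochEdge_one, kochEdge_two, kochEdge_three] <;>
  simp [kochStep, root60] <;> nlinarith

theorem re_kochStep_add_le {i : ℕ} (hi : i < 4) {z : ℂ} (hz : z ∈ triangle 1) :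
    (kochStep i + kochEdge i * z).re ≤
      (if i = 0 then 1 / 3 else if i = 1 then 1 / 2 else if i = 2 then 2 / 3 else 1) := by
  obtain ⟨h1, h2, h3⟩ := hz
  have hs : 0 < √3 := by positivity
  have h := sqrt_three_sq
  interval_cases i <;>
  simp only [kochEdge_zero, kochEdge_one, kochEdge_two, kochEdge_three] <;>
  simp [kochStep, root60] <;> nlinarith

/-- Zoom in at 0 while `k` lies in the first copy. Once it does not, `L = 1` works, as the real part
is then at least 1/3. -/
theorem exists_initial_triangle {n k : ℕ} (h0 : 0 < k) (hk : k ≤ 4 ^ n) :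
    ∃ L > 0, (∀ l ≤ k, kochPoint n l ∈ triangle L) ∧ L / 3 ≤ ‖kochPoint n k‖ := by
  induction n generalizing k with
  | zero =>
    obtain rfl : k = 1 := by simp at hk; omega
    exact ⟨1, one_pos, fun l hl => kochPoint_mem_triangle (by simpa using hl),
      by norm_num [kochPoint_zero_one]⟩
  | succ n ih =>
    obtain ⟨i, hi, m, hm0, hm, rfl⟩ := exists_copy_of_pos h0 hk
    rcases Nat.eq_zero_or_pos i with rfl | hi0
    · have key : ∀ l ≤ 4 ^ n, kochPoint (n + 1) l = 1 / 3 * kochPoint n l := by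
        intro l hl
        have := kochPoint_similar (i := 0) (by norm_num) n hl
        simpa [kochStep, kochEdge_zero] using this
      simp only [zero_mul, zero_add]
      obtain ⟨L, hL, h1, h2⟩ := ih hm0 hm
      refine ⟨L / 3, by positivity, fun l hl => ?_, ?_⟩
      · rw [key l (hl.trans hm)]
        obtain ⟨a, b, c⟩ := h1 l hl
        simp [triangle]
        refine ⟨a, ?_, ?_⟩ <;> linarith
      · rw [key m hm, norm_mul]
        norm_num
        linarith
    · refine ⟨1, one_pos, fun l hl => kochPoint_mem_triangle (hl.trans hk), ?_⟩
      rw [kochPoint_similar hi n hm]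
      refine le_trans ?_ (Complex.re_le_norm _)
      refine le_trans ?_ (re_kochStep_add_ge hi (kochPoint_mem_triangle hm))
      split_ifs <;> first | omega | norm_num

/-- The mirror image, zooming in at 1: `z ↦ conj (1 - z)` is the reflection in the line Re z = 1/2.
-/
theorem exists_final_triangle {n k : ℕ} (hk : k < 4 ^ n) :
    ∃ L > 0, (∀ l, k ≤ l → l ≤ 4 ^ n →
      starRingEnd ℂ (1 - kochPoint n l) ∈ triangle L) ∧ L / 3 ≤ ‖1 - kochPoint n k‖ := by
  have conj_mem : ∀ z ∈ triangle 1, starRingEnd ℂ (1 - z) ∈ triangle 1 := by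
    rintro z ⟨a, b, c⟩
    simp [triangle]
    exact ⟨a, c, b⟩
  induction n generalizing k with
  | zero =>
    obtain rfl : k = 0 := by simpa using hk
    exact ⟨1, one_pos, fun l _ hl => conj_mem _ (kochPoint_mem_triangle hl),
      by norm_num [kochPoint_zero_zero]⟩
  | succ n ih =>
    obtain ⟨i, hi, m, hm, rfl⟩ := exists_copy_of_lt hk
    obtain rfl | hi3 : i = 3 ∨ i < 3 := by omega
    · have key : ∀ l ≤ 4 ^ n, 1 - kochPoint (n + 1) (3 * 4 ^ n + l) =
          1 / 3 * (1 - kochPoint n l) := by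
        intro l hl
        rw [kochPoint_similar (i := 3) (by norm_num) n hl, kochEdge_three]
        simp [kochStep]
        ring
      obtain ⟨L, hL, h1, h2⟩ := ih hm
      refine ⟨L / 3, by positivity, fun l hl hl' => ?_, ?_⟩
      · obtain ⟨l, rfl⟩ := Nat.exists_eq_add_of_le (show 3 * 4 ^ n ≤ l by omega)
        have hln : l ≤ 4 ^ n := by rw [pow_succ] at hl'; omega
        rw [key l hln]
        obtain ⟨a, b, c⟩ := h1 l (by omega) hln
        simp [triangle] at a b c ⊢
        refine ⟨a, ?_, ?_⟩ <;> linarith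
      · rw [key m hm.le, norm_mul]
        norm_num
        linarith
    · refine ⟨1, one_pos, fun l _ hl => conj_mem _ (kochPoint_mem_triangle hl), ?_⟩
      rw [kochPoint_similar hi n hm.le]
      refine le_trans ?_ (Complex.re_le_norm _)
      have := re_kochStep_add_le hi (kochPoint_mem_triangle hm.le)
      rw [Complex.sub_re, Complex.one_re, le_sub_comm]
      refine this.trans ?_
      split_ifs <;> first | omega | norm_num

/-! ### Bounding rectangles. -/

/-- The points of `s` lie in a rectangle with sides `X`, `Y` parallel to `d`, `d * I` (in units of
`‖d‖`) whose diagonal is at most `6 * ‖u - v‖`. -/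
def BoxBound (s : Set ℂ) (u v : ℂ) : Prop :=
  ∃ c d : ℂ, d ≠ 0 ∧ ∃ X > 0, ∃ Y > 0,
    (∀ p ∈ s, ∃ x y : ℝ, 0 ≤ x ∧ x ≤ X ∧ 0 ≤ y ∧ y ≤ Y ∧ p = c + (x + y * Complex.I) * d) ∧
    ‖d‖ ^ 2 * (X ^ 2 + Y ^ 2) ≤ 36 * ‖u - v‖ ^ 2

theorem BoxBound.mono {s t : Set ℂ} {u v : ℂ} (h : BoxBound t u v) (hst : s ⊆ t) :
    BoxBound s u v := by
  obtain ⟨c, d, hd, X, hX, Y, hY, h1, h2⟩ := h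
  exact ⟨c, d, hd, X, hX, Y, hY, fun p hp => h1 p (hst hp), h2⟩

theorem BoxBound.similar {s : Set ℂ} {u v : ℂ} (h : BoxBound s u v) (p : ℂ) {q : ℂ}
    (hq : q ≠ 0) : BoxBound ((fun z => p + q * z) '' s) (p + q * u) (p + q * v) := by
  obtain ⟨c, d, hd, X, hX, Y, hY, h1, h2⟩ := h
  refine ⟨p + q * c, q * d, mul_ne_zero hq hd, X, hX, Y, hY, ?_, ?_⟩
  · rintro _ ⟨z, hz, rfl⟩
    obtain ⟨x, y, hx, hx', hy, hy', rfl⟩ := h1 z hz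
    exact ⟨x, y, hx, hx', hy, hy', by ring⟩
  · rw [add_sub_add_left_eq_sub, ← mul_sub, norm_mul, norm_mul]
    nlinarith [mul_le_mul_of_nonneg_left h2 (sq_nonneg ‖q‖)]

/-- An axis-parallel rectangle yields a `BoxBound`. -/
theorem boxBound_of_bounds {s : Set ℂ} {u v : ℂ} (x₀ x₁ y₀ y₁ : ℝ) (hx : x₀ < x₁) (hy : y₀ < y₁)
    (h : ∀ p ∈ s, x₀ ≤ p.re ∧ p.re ≤ x₁ ∧ y₀ ≤ p.im ∧ p.im ≤ y₁)
    (hd : (x₁ - x₀) ^ 2 + (y₁ - y₀) ^ 2 ≤ 36 * ‖u - v‖ ^ 2) : BoxBound s u v := by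
  refine ⟨⟨x₀, y₀⟩, 1, one_ne_zero, x₁ - x₀, by linarith, y₁ - y₀, by linarith, ?_, by simpa⟩
  intro p hp
  obtain ⟨a, b, c, d⟩ := h p hp
  refine ⟨p.re - x₀, p.im - y₀, by linarith, by linarith, by linarith, by linarith, ?_⟩
  apply Complex.ext <;> simp

/-- If the angle between `u` and `v` is at least `π / 3`, then `v` has distance at least
`√3 / 2 * ‖u‖` from `u`. -/
theorem norm_sub_sq_ge {u v : ℂ}
    (h : √3 * (u.re * v.re + u.im * v.im) ≤ |u.re * v.im - u.im * v.re|) :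
    3 / 4 * ‖u‖ ^ 2 ≤ ‖u - v‖ ^ 2 := by
  simp only [Complex.sq_norm, Complex.normSq_apply, Complex.sub_re, Complex.sub_im]
  rcases le_or_gt (u.re * v.re + u.im * v.im) 0 with hd | hd
  · nlinarith [sq_nonneg u.re, sq_nonneg u.im, sq_nonneg v.re, sq_nonneg v.im]
  · have h1 : 3 * (u.re * v.re + u.im * v.im) ^ 2 ≤ (u.re * v.im - u.im * v.re) ^ 2 := by
      rw [← sq_abs (u.re * v.im - u.im * v.re)]
      have := pow_le_pow_left₀ (by positivity) h 2
      rw [mul_pow, Real.sq_sqrt (by norm_num)] at this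
      exact this
    set U := u.re ^ 2 + u.im ^ 2 with hU
    set V := v.re ^ 2 + v.im ^ 2 with hV
    have hU0 : 0 ≤ U := by positivity
    have hV0 : 0 ≤ V := by positivity
    -- With D the inner product, Lagrange's identity turns `h1` into 4D² ≤ UV, and UV ≤ (U/4 + V)²
    -- by AM-GM.
    have h2 : (2 * (u.re * v.re + u.im * v.im)) ^ 2 ≤ (U / 4 + V) ^ 2 := by
      have : 4 * (u.re * v.re + u.im * v.im) ^ 2 ≤ U * V := by rw [hU, hV]; nlinarith
      nlinarith [sq_nonneg (U / 4 - V)]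
    have h3 := le_of_sq_le_sq h2 (by positivity)
    nlinarith

theorem mem_triangle_im_le {L : ℝ} {z : ℂ} (hz : z ∈ triangle L) : z.im ≤ √3 / 6 * L := by
  obtain ⟨h1, h2, h3⟩ := hz
  have hs : 0 < √3 := by positivity
  have h : √3 * (2 * √3 * z.im) ≤ √3 * L := mul_le_mul_of_nonneg_left (by linarith) hs.le
  nlinarith [sqrt_three_sq]

/-- Two triangles that meet at their endpoints in an angle of `π / 3`. -/
theorem boxBound_adjacent {η : ℂ} (hη : η = root60 ∨ η = -root60) {s t : Set ℂ} {u v : ℂ}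
    {L M : ℝ} (hL : 0 < L) (hs : ∀ p ∈ s, starRingEnd ℂ (-p) ∈ triangle L)
    (ht : ∀ p ∈ t, p ∈ triangle M) (hu : u ∈ s) (hv : v ∈ t)
    (hLu : L / 3 ≤ ‖u‖) (hMv : M / 3 ≤ ‖v‖) (hM : 0 < M) :
    BoxBound (s ∪ (fun z => η * z) '' t) u (η * v) := by
  have hr : 0 < √3 := by positivity
  have h3 := sqrt_three_sq
  have hnη : ‖η‖ = 1 := by rcases hη with rfl | rfl <;> simp [norm_root60]
  have hangle : √3 * (u.re * (η * v).re + u.im * (η * v).im) ≤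
      |u.re * (η * v).im - u.im * (η * v).re| := by
    obtain ⟨a1, a2, -⟩ := hs u hu
    obtain ⟨b1, b2, -⟩ := ht v hv
    simp at a1 a2
    -- The claim is bilinear in `u` and `v`, so it follows from the products of the inequalities
    -- that define the two cones at 0.
    have c1 := mul_nonneg a1 b1
    have c2 := mul_nonneg a1 (sub_nonneg.2 b2)
    have c3 := mul_nonneg (sub_nonneg.2 a2) b1
    have c4 := mul_nonneg (sub_nonneg.2 a2) (sub_nonneg.2 b2)
    have d1 := mul_nonneg hr.le c1
    have d2 := mul_nonneg hr.le c2
    have d3 := mul_nonneg hr.le c3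
    have d4 := mul_nonneg hr.le c4
    rcases hη with rfl | rfl
    · refine le_trans ?_ (neg_le_abs _)
      simp [root60]
      have e : √3 * √3 * √3 = 3 * √3 := by rw [h3]
      nlinarith
    · refine le_trans ?_ (le_abs_self _)
      simp [root60]
      nlinarith
  have hd1 := norm_sub_sq_ge hangle
  have hd2 : 3 / 4 * ‖η * v‖ ^ 2 ≤ ‖u - η * v‖ ^ 2 := by
    rw [norm_sub_rev]
    refine norm_sub_sq_ge (le_trans (le_of_eq ?_) (hangle.trans (le_of_eq ?_)))
    · ring
    · rw [← abs_neg]; congr 1; ring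
  rw [norm_mul, hnη, one_mul] at hd2
  -- N = max(L, M); the factor 36 comes from ‖u - ηv‖² ≥ 3/4 · (N/3)² = N²/12.
  obtain ⟨N, hN, hLN, hMN, hNd⟩ : ∃ N > 0, L ≤ N ∧ M ≤ N ∧ 3 * N ^ 2 ≤ 36 * ‖u - η * v‖ ^ 2 := by
    have e1 := pow_le_pow_left₀ (by positivity) hLu 2
    have e2 := pow_le_pow_left₀ (by positivity) hMv 2
    rcases le_total L M with h | h
    · exact ⟨M, hM, h, le_rfl, by linarith⟩
    · exact ⟨L, hL, le_rfl, h, by linarith⟩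
  have hs' : ∀ p ∈ s, -N ≤ p.re ∧ p.re ≤ 0 ∧ 0 ≤ p.im ∧ p.im ≤ √3 / 6 * N := by
    intro p hp
    have h := triangle_mono hLN (hs p hp)
    have h' := mem_triangle_im_le h
    obtain ⟨a1, a2, a3⟩ := h
    simp at a1 a2 a3 h'
    have := mul_nonneg hr.le a1
    exact ⟨by linarith, by linarith, a1, h'⟩
  have ht' : ∀ p ∈ t, p ∈ triangle N := fun p hp => triangle_mono hMN (ht p hp)
  have hrN : 0 < √3 * N := by positivity
  rcases hη with rfl | rfl
  -- The squared diagonal is (9/4 + 3/4)N² = 3N², so this case uses up the constant 6 exactly. The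
  -- other turn only needs 7N²/3.
  · refine boxBound_of_bounds (-N) (N / 2) 0 (√3 / 2 * N) (by linarith) (by positivity) ?_ ?_
    · rintro p (hp | ⟨p, hp, rfl⟩)
      · obtain ⟨a1, a2, a3, a4⟩ := hs' p hp
        exact ⟨a1, by linarith, a3, by linarith⟩
      · obtain ⟨a1, a2, a3⟩ := ht' p hp
        have b1 := mul_nonneg hr.le a1
        have b2 := mul_le_mul_of_nonneg_left a2 hr.le
        have b3 := mul_le_mul_of_nonneg_left a3 hr.le
        simp [root60]
        refine ⟨?_, ?_, ?_, ?_⟩ <;> nlinarith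
    · nlinarith
  · refine boxBound_of_bounds (-N) 0 (-(√3 / 2 * N)) (√3 / 6 * N) (by linarith) (by linarith) ?_ ?_
    · rintro p (hp | ⟨p, hp, rfl⟩)
      · obtain ⟨a1, a2, a3, a4⟩ := hs' p hp
        exact ⟨a1, by linarith, by linarith, by linarith⟩
      · obtain ⟨a1, a2, a3⟩ := ht' p hp
        have b1 := mul_nonneg hr.le a1
        have b2 := mul_le_mul_of_nonneg_left a2 hr.le
        have b3 := mul_le_mul_of_nonneg_left a3 hr.le
        simp [root60]
        refine ⟨?_, ?_, ?_, ?_⟩ <;> nlinarith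
    · nlinarith

/-- The curve turns by 60°, -120° and 60°; `-root60` is the rotation by -120°. -/
theorem exists_turn {i : ℕ} (hi : i < 3) :
    ∃ η : ℂ, (η = root60 ∨ η = -root60) ∧ kochEdge (i + 1) = kochEdge i * η := by
  have h := root60_sq
  interval_cases i
  · exact ⟨_, Or.inl rfl, by rw [kochEdge_zero, kochEdge_one]⟩
  · refine ⟨_, Or.inr rfl, ?_⟩
    rw [kochEdge_one, kochEdge_two]
    linear_combination (1 / 3) * h
  · refine ⟨_, Or.inl rfl, ?_⟩
    rw [kochEdge_two, kochEdge_three]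
    linear_combination (1 / 3) * h

/-- A piece of the curve of small horizontal extent whose ends are far apart. -/
theorem boxBound_of_gap {s : Set ℂ} {u v : ℂ} (x₀ x₁ g : ℝ) (hx : x₀ < x₁)
    (hs : ∀ p ∈ s, x₀ ≤ p.re ∧ p.re ≤ x₁ ∧ p ∈ triangle 1) (hg : 0 ≤ g)
    (huv : g ≤ v.re - u.re) (h : (x₁ - x₀) ^ 2 + 1 / 12 ≤ 36 * g ^ 2) : BoxBound s u v := by
  refine boxBound_of_bounds x₀ x₁ 0 (√3 / 6) hx (by positivity) (fun p hp => ?_) ?_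
  · obtain ⟨h1, h2, h3⟩ := hs p hp
    exact ⟨h1, h2, h3.1, by simpa using mem_triangle_im_le h3⟩
  · have h1 : g ≤ ‖u - v‖ := by
      rw [norm_sub_rev]; exact huv.trans (Complex.re_le_norm (v - u))
    have h2 := pow_le_pow_left₀ hg h1 2
    nlinarith [sqrt_three_sq]

theorem boxBound_kochPoint {n a b : ℕ} (hab : a < b) (hb : b ≤ 4 ^ n) :
    BoxBound (kochPoint n '' Set.Icc a b) (kochPoint n a) (kochPoint n b) := by
  induction n generalizing a b with
  | zero =>
    obtain ⟨rfl, rfl⟩ : a = 0 ∧ b = 1 := by simp at hb; omega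
    refine boxBound_of_gap 0 1 1 one_pos ?_ zero_le_one ?_ (by norm_num)
    · rintro _ ⟨k, hk, rfl⟩
      have h := kochPoint_mem_triangle (n := 0) (by simpa using hk.2)
      have h' := mul_nonneg (Real.sqrt_nonneg 3) h.1
      exact ⟨h'.trans h.2.1, by linarith [h.2.2], h⟩
    · simp [kochPoint_zero_zero, kochPoint_zero_one]
  | succ n ih =>
    obtain ⟨i, hi, l, hl, rfl⟩ := exists_copy_of_lt (hab.trans_le hb)
    obtain ⟨j, hj, m, hm0, hm, rfl⟩ := exists_copy_of_pos (by omega) hb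
    have hij : i ≤ j := by
      by_contra! h
      have := Nat.mul_le_mul_right (4 ^ n) (show j + 1 ≤ i from h)
      rw [add_mul] at this
      omega
    have cover : ∀ k ∈ Set.Icc (i * 4 ^ n + l) (j * 4 ^ n + m), ∃ i' r, i ≤ i' ∧ i' ≤ j ∧
        r ≤ 4 ^ n ∧ (i' = i → l ≤ r) ∧ (i' = j → r ≤ m) ∧ k = i' * 4 ^ n + r := by
      rintro k ⟨hk1, hk2⟩
      -- The last index is kept in copy `j`: if `m = 4 ^ n`, `exists_copy_of_lt` would put it into
      -- the next copy.
      rcases hk2.eq_or_lt with rfl | hk3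
      · exact ⟨j, m, hij, le_rfl, hm, by rintro rfl; omega, fun _ => le_rfl, rfl⟩
      · obtain ⟨i', -, r, hr, rfl⟩ := exists_copy_of_lt (hk3.trans_le hb)
        refine ⟨i', r, ?_, ?_, hr.le, by rintro rfl; omega, by rintro rfl; omega, rfl⟩
        · by_contra! h
          have := Nat.mul_le_mul_right (4 ^ n) (show i' + 1 ≤ i from h)
          rw [add_mul] at this
          omega
        · by_contra! h
          have := Nat.mul_le_mul_right (4 ^ n) (show j + 1 ≤ i' from h)
          rw [add_mul] at this
          omega
    rw [kochPoint_similar hi n hl.le, kochPoint_similar hj n hm]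
    obtain rfl | rfl | hfar : j = i ∨ j = i + 1 ∨ i + 2 ≤ j := by omega
    · refine ((ih (by omega) hm).similar (kochStep j) (kochEdge_ne_zero hi)).mono ?_
      rintro _ ⟨k, hk, rfl⟩
      obtain ⟨i', r, h1, h2, h3, h4, h5, rfl⟩ := cover k hk
      obtain rfl := le_antisymm h1 h2
      rw [kochPoint_similar hi n h3]
      exact ⟨_, ⟨r, ⟨h4 rfl, h5 rfl⟩, rfl⟩, rfl⟩
    · obtain ⟨η, hη, hturn⟩ := exists_turn (i := i) (by omega)
      obtain ⟨M, hM, hM1, hM2⟩ := exists_initial_triangle hm0 hm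
      obtain ⟨L, hL, hL1, hL2⟩ := exists_final_triangle hl
      -- Coordinates in which the common vertex is 0 and the copy `i` has its base along the real
      -- axis.
      have key := boxBound_adjacent hη
        (s := (fun k => kochPoint n k - 1) '' Set.Icc l (4 ^ n))
        (t := kochPoint n '' Set.Iic m) hL (by
          rintro _ ⟨k, hk, rfl⟩
          simpa using hL1 k hk.1 hk.2) (by
          rintro _ ⟨k, hk, rfl⟩
          exact hM1 k hk)
        (Set.mem_image_of_mem _ ⟨le_rfl, hl.le⟩) (Set.mem_image_of_mem _ (Set.mem_Iic.2 le_rfl))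
        (by rwa [norm_sub_rev]) hM2 hM
      have hstep : kochStep (i + 1) = kochStep i + kochEdge i := by simp [kochEdge]
      have e1 : ∀ z, kochStep (i + 1) + kochEdge i * (z - 1) = kochStep i + kochEdge i * z := by
        intro z; rw [hstep]; ring
      have e2 : ∀ z, kochStep (i + 1) + kochEdge i * (η * z) =
          kochStep (i + 1) + kochEdge (i + 1) * z := by
        intro z; rw [hturn]; ring
      have key' := key.similar (kochStep (i + 1)) (kochEdge_ne_zero hi)
      rw [e1, e2] at key'
      refine key'.mono ?_
      rintro _ ⟨k, hk, rfl⟩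
      obtain ⟨i', r, h1, h2, h3, h4, h5, rfl⟩ := cover k hk
      obtain rfl | rfl : i' = i ∨ i' = i + 1 := by omega
      · rw [kochPoint_similar hi n h3]
        exact ⟨_, Or.inl ⟨r, ⟨h4 rfl, h3⟩, rfl⟩, e1 _⟩
      · rw [kochPoint_similar hj n h3]
        exact ⟨_, Or.inr ⟨_, ⟨r, h5 rfl, rfl⟩, rfl⟩, e2 _⟩
    · have hu := re_kochStep_add_le hi (kochPoint_mem_triangle hl.le)
      have hv := re_kochStep_add_ge hj (kochPoint_mem_triangle hm)
      have hs : ∀ p ∈ kochPoint (n + 1) '' Set.Icc (i * 4 ^ n + l) (j * 4 ^ n + m),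
          p ∈ triangle 1 ∧ ∃ i', i ≤ i' ∧ i' ≤ j ∧
          (if i' = 0 then 0 else if i' = 1 then 1 / 3 else if i' = 2 then 1 / 2 else 2 / 3) ≤ p.re ∧
          p.re ≤
            (if i' = 0 then 1 / 3 else if i' = 1 then 1 / 2 else if i' = 2 then 2 / 3 else 1) := by
        rintro _ ⟨k, hk, rfl⟩
        refine ⟨kochPoint_mem_triangle (hk.2.trans hb), ?_⟩
        obtain ⟨i', r, h1, h2, h3, -, -, rfl⟩ := cover k hk
        have hi' : i' < 4 := by omega
        rw [kochPoint_similar hi' n h3]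
        exact ⟨i', h1, h2, re_kochStep_add_ge hi' (kochPoint_mem_triangle h3),
          re_kochStep_add_le hi' (kochPoint_mem_triangle h3)⟩
      obtain ⟨rfl, rfl⟩ | ⟨rfl, rfl⟩ | ⟨rfl, rfl⟩ :
        (i = 0 ∧ j = 2) ∨ (i = 0 ∧ j = 3) ∨ (i = 1 ∧ j = 3) := by omega
      · refine boxBound_of_gap 0 (2 / 3) (1 / 6) (by norm_num) (fun p hp => ?_) (by norm_num) ?_
          (by norm_num)
        · obtain ⟨h, i', h1, h2, h3, h4⟩ := hs p hp
          interval_cases i' <;> norm_num at h3 h4 <;> exact ⟨by linarith, by linarith, h⟩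
        · norm_num at hu hv ⊢; linarith
      · refine boxBound_of_gap 0 1 (1 / 3) (by norm_num) (fun p hp => ?_) (by norm_num) ?_
          (by norm_num)
        · obtain ⟨h, i', h1, h2, h3, h4⟩ := hs p hp
          interval_cases i' <;> norm_num at h3 h4 <;> exact ⟨by linarith, by linarith, h⟩
        · norm_num at hu hv ⊢; linarith
      · refine boxBound_of_gap (1 / 3) 1 (1 / 6) (by norm_num) (fun p hp => ?_) (by norm_num) ?_
          (by norm_num)
        · obtain ⟨h, i', h1, h2, h3, h4⟩ := hs p hp
          interval_cases i' <;> norm_num at h3 h4 <;> exact ⟨by linarith, by linarith, h⟩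
        · norm_num at hu hv ⊢; linarith

/-- The sides are positive, so the bound also shows that the Koch curve never revisits a vertex. -/
theorem BoxBound.ne {s : Set ℂ} {u v : ℂ} (h : BoxBound s u v) : u ≠ v := by
  obtain ⟨c, d, hd, X, hX, Y, hY, -, h2⟩ := h
  rintro rfl
  have : 0 < ‖d‖ ^ 2 * (X ^ 2 + Y ^ 2) := by positivity
  simp at h2
  linarith

theorem kochPoint_injOn (n : ℕ) : Set.InjOn (kochPoint n) (Set.Iic (4 ^ n)) := by
  intro a ha b hb h
  rcases lt_trichotomy a b with hab | rfl | hab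
  · exact ((boxBound_kochPoint hab hb).ne h).elim
  · rfl
  · exact ((boxBound_kochPoint hab ha).ne h.symm).elim

/-! ### Transfer to the Euclidean plane -/

/-- Planar points as complex numbers. -/
def toComplex (p : EuclideanSpace ℝ (Fin 2)) : ℂ := ⟨p 0, p 1⟩

theorem dist_eq_norm_toComplex_sub (p q : EuclideanSpace ℝ (Fin 2)) :
    dist p q = ‖toComplex p - toComplex q‖ := by
  rw [EuclideanSpace.dist_eq, Complex.norm_def, Complex.normSq_apply]
  simp [toComplex, Real.dist_eq, ← sq]

theorem convex_region (R : Rectangle) : Convex ℝ R.region := by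
  rintro _ ⟨x, y, hx, hx', hy, hy', rfl⟩ _ ⟨x', y', kx, kx', ky, ky', rfl⟩ a b ha hb hab
  refine ⟨a * x + b * x', a * y + b * y', by positivity, ?_, by positivity, ?_, ?_⟩
  · calc a * x + b * x' ≤ a * R.side₁ + b * R.side₁ := by gcongr
      _ = R.side₁ := by rw [← add_mul, hab, one_mul]
  · calc a * y + b * y' ≤ a * R.side₂ + b * R.side₂ := by gcongr
      _ = R.side₂ := by rw [← add_mul, hab, one_mul]
  · obtain rfl : b = 1 - a := by linarith
    module

theorem dist_le_diagonal (R : Rectangle) {p q : EuclideanSpace ℝ (Fin 2)} (hp : p ∈ R.region)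
    (hq : q ∈ R.region) : dist p q ≤ R.diagonal := by
  obtain ⟨x, y, hx, hx', hy, hy', rfl⟩ := hp
  obtain ⟨x', y', kx, kx', ky, ky', rfl⟩ := hq
  refine Real.le_sqrt_of_sq_le ?_
  have e : R.corner + x • R.dir₁ + y • R.dir₂ - (R.corner + x' • R.dir₁ + y' • R.dir₂) =
      (x - x') • R.dir₁ + (y - y') • R.dir₂ := by module
  rw [dist_eq_norm, e, norm_add_sq_real, norm_smul, norm_smul, R.norm_dir₁, R.norm_dir₂,
    real_inner_smul_left, real_inner_smul_right, R.orthogonal]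
  simp only [mul_one, mul_zero, add_zero, Real.norm_eq_abs]
  have h1 : |x - x'| ≤ R.side₁ := abs_le.2 ⟨by linarith, by linarith⟩
  have h2 : |y - y'| ≤ R.side₂ := abs_le.2 ⟨by linarith, by linarith⟩
  gcongr

theorem BoxBound.exists_rectangle {s : Set (EuclideanSpace ℝ (Fin 2))}
    {u v : EuclideanSpace ℝ (Fin 2)} (h : BoxBound (toComplex '' s) (toComplex u) (toComplex v)) :
    ∃ R : Rectangle, s ⊆ R.region ∧ R.diagonal ≤ 6 * dist u v := by
  obtain ⟨c, d, hd, X, hX, Y, hY, h1, h2⟩ := h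
  have hd0 : 0 < ‖d‖ := norm_pos_iff.2 hd
  have hsq : d.re ^ 2 + d.im ^ 2 = ‖d‖ ^ 2 := by
    rw [Complex.sq_norm, Complex.normSq_apply]; ring
  refine ⟨⟨!₂[c.re, c.im], !₂[d.re / ‖d‖, d.im / ‖d‖], !₂[-d.im / ‖d‖, d.re / ‖d‖],
    X * ‖d‖, Y * ‖d‖, ?_, ?_, ?_, by positivity, by positivity⟩, ?_, ?_⟩
  · rw [EuclideanSpace.norm_eq, Real.sqrt_eq_one]
    simp [div_pow, ← add_div, hsq, hd0.ne']
  · rw [EuclideanSpace.norm_eq, Real.sqrt_eq_one]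
    simp [div_pow, ← add_div, add_comm (d.im ^ 2), hsq, hd0.ne']
  · simp [PiLp.inner_apply]
    ring
  · intro p hp
    obtain ⟨x, y, hx, hx', hy, hy', e⟩ := h1 _ ⟨p, hp, rfl⟩
    refine ⟨x * ‖d‖, y * ‖d‖, by positivity, mul_le_mul_of_nonneg_right hx' hd0.le,
      by positivity, mul_le_mul_of_nonneg_right hy' hd0.le, ?_⟩
    have e0 := congrArg Complex.re e
    have e1 := congrArg Complex.im e
    simp [toComplex] at e0 e1
    ext i
    fin_cases i
    · simp [e0]; field_simp; ring
    · simp [e1]; field_simp; ring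
  · rw [dist_eq_norm_toComplex_sub]
    refine Real.sqrt_le_iff.2 ⟨by positivity, ?_⟩
    simp only
    nlinarith

/-! ### Polygonal curves and Fréchet distances -/

/-- Both time changes are the identity; this crude bound is enough when all distances are at most a
diagonal. -/
theorem frechetDist_le {E : Type*} [PseudoMetricSpace E] {a b a' b' : E} {γ₁ : Path a b}
    {γ₂ : Path a' b'} {r : ℝ} (h : ∀ τ, dist (γ₁ τ) (γ₂ τ) ≤ r) : frechetDist γ₁ γ₂ ≤ r := by
  refine csInf_le ⟨0, ?_⟩ ⟨id, id, continuous_id, monotone_id, rfl, rfl, continuous_id,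
    monotone_id, rfl, rfl, h⟩
  rintro r ⟨α, β, -, -, -, -, -, -, -, -, h⟩
  exact dist_nonneg.trans (h 0)

theorem range_polygonalCurve_subset {d : ℕ} {S : Set (EuclideanSpace ℝ (Fin d))}
    {H : SimpleGraph S} {C : Set (EuclideanSpace ℝ (Fin d))} (hC : Convex ℝ C) {u v : S}
    (P : H.Walk u v) (h : ∀ w ∈ P.support, (w : EuclideanSpace ℝ (Fin d)) ∈ C) :
    Set.range (polygonalCurve P) ⊆ C := by
  induction P with
  | nil =>
    rintro _ ⟨t, rfl⟩
    simpa [polygonalCurve] using h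
  | cons hadj p ih =>
    rw [polygonalCurve, Path.trans_range, Path.range_segment]
    refine Set.union_subset (hC.segment_subset (h _ (by simp)) (h _ (by simp))) (ih ?_)
    intro w hw
    exact h w (by simp [hw])

theorem frechetDistToSegment_nil {d : ℕ} {S : Set (EuclideanSpace ℝ (Fin d))}
    {H : SimpleGraph S} (u : S) :
    frechetDistToSegment (SimpleGraph.Walk.nil : H.Walk u u) ≤ 0 := by
  refine frechetDist_le fun τ => ?_
  simp [polygonalCurve]

/-! ### The Koch graphs are paths -/

/-- The `k`-th vertex of `F_n`. -/
noncomputable def kochNode (n k : ℕ) (hk : k ≤ 4 ^ n) : kochVertexSet n := ⟨kochVertex n k, k, hk, rfl⟩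

/-- The position of a vertex of `F_n` along the curve. -/
noncomputable def kochIndex {n : ℕ} (u : kochVertexSet n) : ℕ := Classical.choose u.2

theorem kochIndex_le {n : ℕ} (u : kochVertexSet n) : kochIndex u ≤ 4 ^ n :=
  (Classical.choose_spec u.2).1

theorem kochVertex_kochIndex {n : ℕ} (u : kochVertexSet n) :
    kochVertex n (kochIndex u) = u := (Classical.choose_spec u.2).2.symm

theorem kochPoint_kochIndex {n : ℕ} (u : kochVertexSet n) :
    kochPoint n (kochIndex u) = toComplex u := by
  rw [← kochVertex_kochIndex u]; rfl

theorem kochIndex_injective {n : ℕ} : Function.Injective (kochIndex (n := n)) := by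
  intro u v h
  rw [Subtype.ext_iff, ← kochVertex_kochIndex u, h, kochVertex_kochIndex]

theorem kochIndex_eq {n k : ℕ} (hk : k ≤ 4 ^ n) {u : kochVertexSet n}
    (h : (u : EuclideanSpace ℝ (Fin 2)) = kochVertex n k) : kochIndex u = k := by
  refine kochPoint_injOn n (kochIndex_le u) hk ?_
  rw [kochPoint_kochIndex, h]; rfl

theorem kochGraph_adj_index {n : ℕ} {u v : kochVertexSet n} (h : (kochGraph n).Adj u v) :
    kochIndex v = kochIndex u + 1 ∨ kochIndex u = kochIndex v + 1 := by
  obtain ⟨-, ⟨k, hk, h1, h2⟩ | ⟨k, hk, h1, h2⟩⟩ := (SimpleGraph.fromRel_adj _ _ _).1 h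
  · left; rw [kochIndex_eq hk.le h1, kochIndex_eq hk h2]
  · right; rw [kochIndex_eq hk.le h1, kochIndex_eq hk h2]

theorem kochGraph_adj_kochNode {n k : ℕ} (hk : k < 4 ^ n) :
    (kochGraph n).Adj (kochNode n k hk.le) (kochNode n (k + 1) hk) := by
  refine (SimpleGraph.fromRel_adj _ _ _).2 ⟨fun h => ?_, Or.inl ⟨k, hk, rfl, rfl⟩⟩
  have h1 := kochIndex_eq hk.le (u := kochNode n k hk.le) rfl
  have h2 := kochIndex_eq hk (u := kochNode n (k + 1) hk) rfl
  rw [h] at h1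
  omega

theorem kochGraph_reachable {n : ℕ} (u v : kochVertexSet n) : (kochGraph n).Reachable u v := by
  have key : ∀ k (hk : k ≤ 4 ^ n),
      (kochGraph n).Reachable (kochNode n 0 (Nat.zero_le _)) (kochNode n k hk) := by
    intro k
    induction k with
    | zero => intro _; rfl
    | succ k ih => intro hk; exact (ih (by omega)).trans (kochGraph_adj_kochNode hk).reachable
  have key' : ∀ w : kochVertexSet n,
      (kochGraph n).Reachable (kochNode n 0 (Nat.zero_le _)) w := by
    rintro ⟨_, k, hk, rfl⟩
    exact key k hk
  exact (key' u).symm.trans (key' v)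

/-! ### Lengths and supports of walks. -/

theorem dist_of_kochGraph_adj {n : ℕ} {u v : kochVertexSet n} (h : (kochGraph n).Adj u v) :
    dist u v = (1 / 3) ^ n := by
  rw [Subtype.dist_eq, dist_eq_norm_toComplex_sub, ← kochPoint_kochIndex, ← kochPoint_kochIndex]
  have hu := kochIndex_le u
  have hv := kochIndex_le v
  rcases kochGraph_adj_index h with h | h
  · rw [h, norm_sub_rev]; exact norm_kochPoint_succ_sub (by omega)
  · rw [h]; exact norm_kochPoint_succ_sub (by omega)

theorem walkLength_ge {n : ℕ} {u v : kochVertexSet n} (P : (kochGraph n).Walk u v) :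
    ((kochIndex v : ℝ) - kochIndex u) * (1 / 3) ^ n ≤ walkLength P := by
  induction P with
  | nil => simp [walkLength]
  | @cons u w v h p ih =>
    rw [walkLength, dist_of_kochGraph_adj h]
    have h1 : (kochIndex w : ℝ) ≤ kochIndex u + 1 := by
      have := kochGraph_adj_index h
      exact_mod_cast (by omega : kochIndex w ≤ kochIndex u + 1)
    have h3 : (0 : ℝ) < (1 / 3) ^ n := by positivity
    nlinarith

/-- A discrete intermediate value theorem: each step changes the index by one. -/
theorem mem_support_of_index_between {n : ℕ} {u v w : kochVertexSet n}
    (P : (kochGraph n).Walk u v) (hu : kochIndex u ≤ kochIndex w)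
    (hv : kochIndex w ≤ kochIndex v) : w ∈ P.support := by
  induction P with
  | nil => simp [kochIndex_injective (le_antisymm hv hu)]
  | @cons u x v h p ih =>
    rcases hu.eq_or_lt with hu | hu
    · simp [kochIndex_injective hu]
    · have := kochGraph_adj_index h
      exact List.mem_cons_of_mem _ (ih (by omega) hv)

/-- A first step backwards would force the rest of the walk through `u` again, which a path forbids.
-/
theorem index_mem_Icc_of_mem_support {n : ℕ} {u v : kochVertexSet n}
    (P : (kochGraph n).Walk u v) (hP : P.IsPath) (huv : kochIndex u ≤ kochIndex v) :
    ∀ w ∈ P.support, kochIndex w ∈ Set.Icc (kochIndex u) (kochIndex v) := by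
  induction P with
  | nil => simp
  | @cons u x v h p ih =>
    obtain ⟨hp, hu⟩ := (SimpleGraph.Walk.cons_isPath_iff _ _).1 hP
    have hx : ¬ kochIndex x ≤ kochIndex u :=
      fun h' => hu (mem_support_of_index_between p h' huv)
    have hadj := kochGraph_adj_index h
    have hxv : kochIndex x ≤ kochIndex v := by
      rcases huv.eq_or_lt with h' | h'
      · exact absurd (kochIndex_injective h' ▸ p.end_mem_support) hu
      · omega
    intro w hw
    rw [SimpleGraph.Walk.support_cons, List.mem_cons] at hw
    rcases hw with rfl | hw
    · exact ⟨le_rfl, huv⟩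
    · obtain ⟨h1, h2⟩ := ih hp hxv w hw
      exact ⟨by omega, h2⟩

/-! ### The three claims for the Koch graphs. -/

theorem exists_rectangle_support {n : ℕ} {u v : kochVertexSet n} (huv : u ≠ v)
    (P : (kochGraph n).Walk u v) (hP : P.IsPath) :
    ∃ R : Rectangle, (∀ w ∈ P.support, (w : EuclideanSpace ℝ (Fin 2)) ∈ R.region) ∧
      R.diagonal ≤ 6 * dist u v := by
  wlog h : kochIndex u ≤ kochIndex v generalizing u v
  · obtain ⟨R, h1, h2⟩ := this huv.symm P.reverse hP.reverse (le_of_not_ge h)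
    exact ⟨R, fun w hw => h1 w (by simpa using hw), by rwa [dist_comm]⟩
  · have hlt : kochIndex u < kochIndex v := h.lt_of_ne fun h => huv (kochIndex_injective h)
    have hbox := boxBound_kochPoint hlt (kochIndex_le v)
    rw [kochPoint_kochIndex, kochPoint_kochIndex] at hbox
    obtain ⟨R, h1, h2⟩ := BoxBound.exists_rectangle
      (s := {p | ∃ w ∈ P.support, p = (w : EuclideanSpace ℝ (Fin 2))}) (hbox.mono (by
        rintro _ ⟨_, ⟨w, hw, rfl⟩, rfl⟩
        exact ⟨_, index_mem_Icc_of_mem_support P hP h w hw, kochPoint_kochIndex w⟩))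
    exact ⟨R, fun w hw => h1 ⟨w, hw, rfl⟩, h2⟩

theorem exists_rectangle_polygonalCurve {n : ℕ} {u v : kochVertexSet n} (huv : u ≠ v)
    (P : (kochGraph n).Walk u v) (hP : P.IsPath) :
    ∃ R : Rectangle, Set.range (polygonalCurve P) ⊆ R.region ∧
      segment ℝ (u : EuclideanSpace ℝ (Fin 2)) (v : EuclideanSpace ℝ (Fin 2)) ⊆ R.region ∧
      frechetDistToSegment P ≤ R.diagonal ∧ R.diagonal ≤ 6 * dist u v := by
  obtain ⟨R, h1, h2⟩ := exists_rectangle_support huv P hP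
  have hcurve := range_polygonalCurve_subset (convex_region R) P h1
  have hseg := (convex_region R).segment_subset (h1 u P.start_mem_support)
    (h1 v P.end_mem_support)
  refine ⟨R, hcurve, hseg, frechetDist_le fun τ => ?_, h2⟩
  refine dist_le_diagonal R (hcurve ⟨τ, rfl⟩) (hseg ?_)
  rw [← Path.range_segment]
  exact ⟨τ, rfl⟩

theorem isFrechetSpanner_kochGraph (n : ℕ) : IsFrechetSpanner 6 (kochGraph n) := by
  intro u v
  rcases eq_or_ne u v with rfl | huv
  · exact ⟨.nil, .nil, by simpa using frechetDistToSegment_nil u⟩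
  · obtain ⟨P, hP⟩ := (kochGraph_reachable u v).exists_isPath
    obtain ⟨R, -, -, h3, h4⟩ := exists_rectangle_polygonalCurve huv P hP
    exact ⟨P, hP, h3.trans h4⟩

theorem exists_not_isSpanner_kochGraph (t : ℝ) : ∃ n, ¬ IsSpanner t (kochGraph n) := by
  obtain ⟨n, hn⟩ := pow_unbounded_of_one_lt t (by norm_num : (1 : ℝ) < 4 / 3)
  refine ⟨n, fun h => ?_⟩
  obtain ⟨P, -, hP⟩ := h (kochNode n 0 (Nat.zero_le _)) (kochNode n (4 ^ n) le_rfl)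
  have hlen := walkLength_ge P
  have hdist : dist (kochNode n 0 (Nat.zero_le _)) (kochNode n (4 ^ n) le_rfl) = 1 := by
    rw [Subtype.dist_eq, dist_eq_norm_toComplex_sub]
    change ‖kochPoint n 0 - kochPoint n (4 ^ n)‖ = 1
    simp [kochPoint_zero_right, kochPoint_last]
  rw [kochIndex_eq (Nat.zero_le _) (u := kochNode n 0 (Nat.zero_le _)) rfl,
    kochIndex_eq le_rfl (u := kochNode n (4 ^ n) le_rfl) rfl] at hlen
  rw [hdist] at hP
  have e : (((4 ^ n : ℕ) : ℝ) - (0 : ℕ)) * (1 / 3) ^ n = (4 / 3) ^ n := by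
    push_cast
    rw [sub_zero, ← mul_pow]
    norm_num
  linarith

end FrechetSpanner

theorem mainTheorem5 :
    ∃ c : ℝ, 0 < c ∧ c ≤ 6 ∧
      (∀ n : ℕ, FrechetSpanner.IsFrechetSpanner c (FrechetSpanner.kochGraph n)) ∧
      (∀ (n : ℕ) (u v : FrechetSpanner.kochVertexSet n), u ≠ v →
        ∀ P : (FrechetSpanner.kochGraph n).Walk u v, P.IsPath →
          ∃ R : FrechetSpanner.Rectangle,
            Set.range (FrechetSpanner.polygonalCurve P) ⊆ R.region ∧
            segment ℝ (u : EuclideanSpace ℝ (Fin 2)) (v : EuclideanSpace ℝ (Fin 2)) ⊆ R.region ∧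
            FrechetSpanner.frechetDistToSegment P ≤ R.diagonal ∧
            R.diagonal ≤ c * dist u v) ∧
      (∀ t : ℝ, 1 < t →
        ∃ n : ℕ, ¬ FrechetSpanner.IsSpanner t (FrechetSpanner.kochGraph n)) :=
  ⟨6, by norm_num, le_rfl, FrechetSpanner.isFrechetSpanner_kochGraph,
    fun _ _ _ huv P hP => FrechetSpanner.exists_rectangle_polygonalCurve huv P hP,
    fun t _ => FrechetSpanner.exists_not_isSpanner_kochGraph t⟩
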